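/- Let $S^1=\mathbb R/\mathbb Z$ and let $\mathrm{Homeo}_+(S^1)$ be the group, under composition, of orientation-preserving homeomorphisms of $S^1$, i.e. of the homeomorphisms $f$ that have a lift $F:\mathbb R\to\mathbb R$ which is an increasing homeomorphism of $\mathbb R$ (so $F(x) \bmod 1 = f(x \bmod 1)$ for all $x\in\mathbb R$). The rotation number of $f$ is $\mathrm{rot}(f)=\lim_{n\to\infty}F^n(t)/n \bmod 1\in\mathbb R/\mathbb Z$, which does not depend on $t\in\mathbb R$ or on the lift $F$. Let $G$ be a subgroup of $\mathrm{Homeo}_+(S^1)$ such that either 1. every element of $G$ is piecewise linear with at most finitely many breakpoints (for a lift $F$, all but finitely many points of $[0,1)$ have a neighbourhood in $\mathbb R$ on which $F$ is affine), or 2. every element of $G$ is of class $C^1$ and its first derivative has bounded variation. Suppose that some $g\in G$ has $\mathrm{rot}(g)\notin\mathbb Q/\mathbb Z$. Then at least one of the following holds: * $G$ is topologically conjugate to a group of rotations, i.e. there is $h\in\mathrm{Homeo}_+(S^1)$ such that $hgh^{-1}$ is a rotation $x\mapsto x+a_g$ for every $g\in G$; in particular $G$ is abelian; * $G$ contains a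 non-abelian free subgroup. -/

import Mathlib

namespace CircleGroups

open Set Filter Topology

/-- `F` is a lift of the circle map `f` through the covering `ℝ → ℝ/ℤ`. An order automorphism of
`ℝ` is the same thing as an increasing self-homeomorphism of `ℝ`. -/
def IsLift (F : ℝ ≃o ℝ) (f : UnitAddCircle ≃ₜ UnitAddCircle) : Prop :=
  ∀ x : ℝ, ((F x : ℝ) : UnitAddCircle) = f (x : UnitAddCircle)

/-- The group `Homeo₊(S¹)` of orientation-preserving homeomorphisms of `S¹ = ℝ/ℤ`, i.e. of the
homeomorphisms that have an increasing lift to `ℝ`. The product is composition. -/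
def homeoPlus : Subgroup (UnitAddCircle ≃ₜ UnitAddCircle) where
  carrier := {f | ∃ F : ℝ ≃o ℝ, IsLift F f}
  mul_mem' := by
    rintro f g ⟨F, hF⟩ ⟨K, hK⟩
    refine ⟨K.trans F, fun x => ?_⟩
    change ((F (K x) : ℝ) : UnitAddCircle) = f (g x)
    rw [hF, hK]
  one_mem' := ⟨OrderIso.refl ℝ, fun _ => rfl⟩
  inv_mem' := by
    rintro f ⟨F, hF⟩
    refine ⟨F.symm, fun x => ?_⟩
    change ((F.symm x : ℝ) : UnitAddCircle) = f.symm x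
    rw [Homeomorph.eq_symm_apply, ← hF, OrderIso.apply_symm_apply]

/-- The limit of `Fⁿ(0)/n`, reduced mod `1`, for a lift `F` of `f`. The theorem `rot_spec` below
shows that the limit exists, and that neither the lift nor the base point `0` matters. -/
noncomputable def rot (f : homeoPlus) : UnitAddCircle :=
  ((limUnder atTop (fun n : ℕ => (f.2.choose)^[n] 0 / (n : ℝ)) : ℝ) : UnitAddCircle)

/-- `f` is piecewise linear with at most finitely many breakpoints: up to integer translations, there
are only finitely many points near which a lift of `f` is not affine. -/
def IsPL (f : homeoPlus) : Prop :=
  ∃ F : ℝ ≃o ℝ, IsLift F f ∧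
    {x ∈ Ico (0 : ℝ) 1 | ¬ ∃ a b : ℝ, ∀ᶠ y in 𝓝 x, F y = a * y + b}.Finite

/-- `f` is of class `C¹` and its first derivative has bounded variation (over one turn). -/
def IsC1BV (f : homeoPlus) : Prop :=
  ∃ F : ℝ ≃o ℝ, IsLift F f ∧ ContDiff ℝ 1 F ∧ BoundedVariationOn (deriv F) (Icc 0 1)

/-- `G` is conjugate, by an orientation-preserving homeomorphism, to a group of rotations. -/
def IsConjToRotations (G : Subgroup homeoPlus) : Prop :=
  ∃ h : homeoPlus, ∀ g ∈ G, ∃ a : UnitAddCircle, ∀ x : UnitAddCircle,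
    (h * g * h⁻¹ : homeoPlus).1 x = x + a

/-- `G` has a subgroup that is free and not abelian. -/
def HasNonabelianFreeSubgroup (G : Subgroup homeoPlus) : Prop :=
  ∃ H : Subgroup homeoPlus, H ≤ G ∧ IsFreeGroup H ∧ ∃ a ∈ H, ∃ b ∈ H, a * b ≠ b * a

theorem coe_eq_coe_iff {x y : ℝ} :
    (x : UnitAddCircle) = (y : UnitAddCircle) ↔ ∃ k : ℤ, x = y + k := by
  rw [← sub_eq_zero, ← AddCircle.coe_sub, AddCircle.coe_eq_zero_iff]
  constructor
  · rintro ⟨n, hn⟩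
    exact ⟨n, by simp at hn; linarith⟩
  · rintro ⟨n, hn⟩
    exact ⟨n, by simp; linarith⟩

theorem IsLift.map_add_one {F : ℝ ≃o ℝ} {f : UnitAddCircle ≃ₜ UnitAddCircle} (hF : IsLift F f)
    (x : ℝ) : F (x + 1) = F x + 1 := by
  have h1 : ((F (x + 1) : ℝ) : UnitAddCircle) = (F x : ℝ) := by
    rw [hF, hF, (coe_eq_coe_iff (x := x + 1) (y := x)).2 ⟨1, by simp⟩]
  obtain ⟨k, hk⟩ := coe_eq_coe_iff.1 h1
  have h2 : F x < F (x + 1) := F.strictMono (by linarith)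
  have hk0 : 0 < k := by
    have : (0 : ℝ) < k := by linarith
    exact_mod_cast this
  rcases (show k = 1 ∨ 2 ≤ k by omega) with rfl | hk2
  · simpa using hk
  exfalso
  have hk2' : (2 : ℝ) ≤ k := by exact_mod_cast hk2
  obtain ⟨y, hy⟩ := F.surjective (F x + 1)
  have hxy : x < y := F.lt_iff_lt.1 (by linarith)
  have hyx : y < x + 1 := F.lt_iff_lt.1 (by linarith)
  have h3 : f (y : UnitAddCircle) = f (x : UnitAddCircle) := by
    rw [← hF, ← hF, hy, coe_eq_coe_iff]
    exact ⟨1, by simp⟩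
  obtain ⟨m, hm⟩ := coe_eq_coe_iff.1 (f.injective h3)
  have hm0 : (0 : ℝ) < m := by linarith
  have hm1 : (m : ℝ) < 1 := by linarith
  have hm0' : 0 < m := by exact_mod_cast hm0
  have hm1' : m < 1 := by exact_mod_cast hm1
  omega

/-- A lift, as an element of Mathlib's monoid of lifts of degree one circle maps. -/
def IsLift.toDeg1 {F : ℝ ≃o ℝ} {f : UnitAddCircle ≃ₜ UnitAddCircle} (hF : IsLift F f) :
    CircleDeg1Lift :=
  ⟨⟨F, F.monotone⟩, hF.map_add_one⟩

theorem IsLift.toDeg1_apply {F : ℝ ≃o ℝ} {f : UnitAddCircle ≃ₜ UnitAddCircle} (hF : IsLift F f)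
    (x : ℝ) : hF.toDeg1 x = F x := rfl

theorem IsLift.tendsto {F : ℝ ≃o ℝ} {f : UnitAddCircle ≃ₜ UnitAddCircle} (hF : IsLift F f)
    (t : ℝ) : Tendsto (fun n : ℕ => F^[n] t / (n : ℝ)) atTop
      (𝓝 hF.toDeg1.translationNumber) := by
  have h := hF.toDeg1.tendsto_translationNumber t
  have h' := h.add (tendsto_const_div_atTop_nhds_zero_nat t)
  rw [add_zero] at h'
  refine h'.congr fun n => ?_
  rw [← add_div, CircleDeg1Lift.coe_pow, sub_add_cancel]
  rfl

/-- Two lifts of the same homeomorphism differ by an integer translation. -/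
theorem IsLift.exists_int {F K : ℝ ≃o ℝ} {f : UnitAddCircle ≃ₜ UnitAddCircle} (hF : IsLift F f)
    (hK : IsLift K f) : ∃ k : ℤ, ∀ x, K x = F x + k := by
  have h : ∀ x, ∃ k : ℤ, K x = F x + k := fun x =>
    coe_eq_coe_iff.1 ((hK x).trans (hF x).symm)
  choose m hm using h
  have key : ∀ x, m (Int.fract x) = m 0 := by
    intro x
    have h0 := Int.fract_nonneg x
    have h1 := Int.fract_lt_one x
    set y := Int.fract x
    have a1 : F 0 ≤ F y := F.monotone h0
    have a2 : F y < F 0 + 1 := by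
      rw [← hF.map_add_one]; exact F.strictMono (by linarith)
    have b1 : K 0 ≤ K y := K.monotone h0
    have b2 : K y < K 0 + 1 := by
      rw [← hK.map_add_one]; exact K.strictMono (by linarith)
    have e0 := hm 0
    have e1 := hm y
    have c1 : (m y : ℝ) < m 0 + 1 := by linarith
    have c2 : (m 0 : ℝ) < m y + 1 := by linarith
    have c1' : m y < m 0 + 1 := by exact_mod_cast c1
    have c2' : m 0 < m y + 1 := by exact_mod_cast c2
    omega
  refine ⟨m 0, fun x => ?_⟩
  have e := hm (Int.fract x)
  rw [key] at e
  have e1 := hF.toDeg1.map_fract_sub_fract_eq x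
  have e2 := hK.toDeg1.map_fract_sub_fract_eq x
  simp only [IsLift.toDeg1_apply] at e1 e2
  linarith

/-- The rotation number is well defined, and it can be computed from any lift and any base point. -/
theorem rot_spec (f : homeoPlus) (F : ℝ ≃o ℝ) (hF : IsLift F f) (t : ℝ) :
    ∃ r : ℝ, Tendsto (fun n : ℕ => F^[n] t / (n : ℝ)) atTop (𝓝 r) ∧
      rot f = (r : UnitAddCircle) := by
  refine ⟨_, hF.tendsto t, ?_⟩
  have hC : IsLift f.2.choose f := f.2.choose_spec
  rw [rot, (hC.tendsto 0).limUnder_eq, coe_eq_coe_iff]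
  obtain ⟨k, hk⟩ := hF.exists_int hC
  refine ⟨k, ?_⟩
  have e : hC.toDeg1 =
      (CircleDeg1Lift.translate (Multiplicative.ofAdd (k : ℝ)) : CircleDeg1Lift) * hF.toDeg1 := by
    ext x
    rw [CircleDeg1Lift.mul_apply, CircleDeg1Lift.translate_apply]
    simp only [IsLift.toDeg1_apply]
    rw [hk x, add_comm]
  have hc : Commute
      (CircleDeg1Lift.translate (Multiplicative.ofAdd (k : ℝ)) : CircleDeg1Lift) hF.toDeg1 := by
    ext x
    simp only [CircleDeg1Lift.mul_apply, CircleDeg1Lift.translate_apply]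
    rw [add_comm (k : ℝ) x, CircleDeg1Lift.map_add_int, add_comm]
  rw [e, CircleDeg1Lift.translationNumber_mul_of_commute hc,
    CircleDeg1Lift.translationNumber_translate, add_comm]

end CircleGroups

namespace CircleGroups

open Set Filter Topology

/-! ### Best rational approximations -/

/-! The proof joins Denjoy's theorem to a ping-pong argument. Let `F` lift an element of irrational
rotation number α. Poincaré's monotone `h` semiconjugates `F` to translation by α. An interval
collapsed by `h` would have iterates that are disjoint modulo 1, so their lengths would tend to 0.
At the times `q` of best approximation of α, `log_wandering_bound` keeps the product of the lengths
of the iterates `q` and `-q` away from 0. Hence `h` is a homeomorphism (`strictMono_of_semiconj`,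
`exists_conj_translation`). Both regularity classes enter only through `HasBoundedDistortion`.

After conjugation, the group Γ of all lifts contains a dense group of translations. If Γ consists of
translations, the original group is conjugate to rotations. Otherwise some element changes a
distance, and this yields intervals that Γ makes arbitrarily short (`exists_contractible`). Their
supremal length L divides 1 and commutes with Γ (`exists_period`). So on ℝ/Lℤ the complement of any
short arc can be sent into any other short arc (`exists_proximal`), and ping-pong gives a free group
of rank two. -/

theorem exists_best_approximation {α : ℝ} (hα : Irrational α) (N : ℕ) :
    ∃ q : ℕ, N < q ∧ ∃ p : ℤ, |q * α - p| < 1 ∧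
      ∀ j : ℕ, 0 < j → j < q → ∀ m : ℤ, |q * α - p| < |j * α - m| := by
  classical
  set e : ℕ → ℝ := fun j => |j * α - round (j * α)| with he
  have hpos : ∀ j : ℕ, 0 < j → 0 < e j := by
    intro j hj
    refine abs_pos.2 (sub_ne_zero.2 ?_)
    exact (hα.natCast_mul hj.ne').ne_int _
  obtain ⟨j₀, hj₀, hmin⟩ := Finset.exists_min_image (Finset.Icc 1 (N + 1)) e ⟨1, by simp⟩
  rw [Finset.mem_Icc] at hj₀
  have hex : ∃ q : ℕ, 0 < q ∧ e q < e j₀ := by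
    obtain ⟨n, hn⟩ := exists_nat_one_div_lt (hpos j₀ hj₀.1)
    obtain ⟨k, hk, -, hk'⟩ := Real.exists_nat_abs_mul_sub_round_le α (Nat.succ_pos n)
    refine ⟨k, hk, lt_of_le_of_lt hk' (lt_of_le_of_lt ?_ hn)⟩
    push_cast
    gcongr
    linarith
  -- Taking the first index that beats the record of `1, …, N + 1` gives `q > N` and makes it
  -- strictly better than every earlier index.
  obtain ⟨hq, hqe⟩ := Nat.find_spec hex
  set q := Nat.find hex
  refine ⟨q, ?_, round (q * α), ?_, fun j hj hjq m => ?_⟩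
  · by_contra! hle
    exact absurd (hmin q (Finset.mem_Icc.2 ⟨hq, by omega⟩)) (not_le.2 hqe)
  · exact lt_of_le_of_lt (abs_sub_round _) (by norm_num)
  · have h1 : e j₀ ≤ e j := by
      by_contra! hlt
      exact Nat.find_min hex hjq ⟨hj, hlt⟩
    exact lt_of_lt_of_le hqe (h1.trans (round_le _ m))

/-! ### Sums over disjoint intervals -/

theorem sum_sub_le_of_disjoint {ι : Type*} {W : ℝ → ℝ} {A B : ℝ} (hAB : A ≤ B)
    (hW : MonotoneOn W (Icc A B)) (s : Finset ι) (u v : ι → ℝ) (huv : ∀ i ∈ s, u i ≤ v i)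
    (hA : ∀ i ∈ s, A ≤ u i) (hB : ∀ i ∈ s, v i ≤ B)
    (hd : ∀ i ∈ s, ∀ j ∈ s, i ≠ j → v i < u j ∨ v j < u i) :
    ∑ i ∈ s, (W (v i) - W (u i)) ≤ W B - W A := by
  classical
  -- Induction adds the interval with the largest left end `u a`. The others lie to its left, so the
  -- induction hypothesis is used with `u a` in place of `B`.
  revert B
  refine Finset.induction_on_max_value u (motive := fun s => (∀ i ∈ s, u i ≤ v i) →
    (∀ i ∈ s, A ≤ u i) → (∀ i ∈ s, ∀ j ∈ s, i ≠ j → v i < u j ∨ v j < u i) →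
    ∀ {B : ℝ}, A ≤ B → MonotoneOn W (Icc A B) → (∀ i ∈ s, v i ≤ B) →
    ∑ i ∈ s, (W (v i) - W (u i)) ≤ W B - W A) s ?_ ?_ huv hA hd
  · intro _ _ _ B hAB hW _
    simpa using hW ⟨le_rfl, hAB⟩ ⟨hAB, le_rfl⟩ hAB
  · intro a s has hmax ih huv hA hd B hAB hW hB
    have ha := Finset.mem_insert_self a s
    have hs : ∀ i ∈ s, i ∈ insert a s := fun i hi => Finset.mem_insert_of_mem hi
    have hua : u a ≤ B := (huv a ha).trans (hB a ha)
    rw [Finset.sum_insert has]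
    have h1 := ih (fun i hi => huv i (hs i hi)) (fun i hi => hA i (hs i hi))
      (fun i hi j hj => hd i (hs i hi) j (hs j hj)) (hA a ha)
      (hW.mono (Icc_subset_Icc_right hua)) (fun i hi => by
        rcases hd i (hs i hi) a ha (fun h => has (h ▸ hi)) with h | h
        · exact h.le
        · exact absurd (hmax i hi) (not_le.2 ((huv a ha).trans_lt h)))
    have h2 := hW ⟨(hA a ha).trans (huv a ha), hB a ha⟩ ⟨hAB, le_rfl⟩ (hB a ha)
    linarith

/-- Intervals of length at most `1` that are disjoint modulo `1`, moved into `[0, 2]`. -/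
theorem sum_sub_le_of_disjoint_mod_one {ι : Type*} {W : ℝ → ℝ} (hW : MonotoneOn W (Icc 0 2))
    (s : Finset ι) (u v : ι → ℝ) (huv : ∀ i ∈ s, u i ≤ v i) (hlen : ∀ i ∈ s, v i ≤ u i + 1)
    (hd : ∀ i ∈ s, ∀ j ∈ s, i ≠ j → ∀ m : ℤ, ∀ z ∈ Icc (u i) (v i), z + m ∉ Icc (u j) (v j)) :
    ∑ i ∈ s, (W (v i - ⌊u i⌋) - W (u i - ⌊u i⌋)) ≤ W 2 - W 0 := by
  refine sum_sub_le_of_disjoint zero_le_two hW s (fun i => u i - ⌊u i⌋) (fun i => v i - ⌊u i⌋)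
    (fun i hi => sub_le_sub_right (huv i hi) _) (fun i _ => ?_) (fun i hi => ?_) ?_
  · linarith [Int.floor_le (u i)]
  · linarith [Int.lt_floor_add_one (u i), hlen i hi]
  · intro i hi j hj hij
    by_contra! hcon
    obtain ⟨h1, h2⟩ := hcon
    -- If two translated intervals meet, the larger of their left ends lies in both.
    rcases le_total (u i - ⌊u i⌋) (u j - ⌊u j⌋) with h | h
    · refine hd i hi j hj hij (⌊u j⌋ - ⌊u i⌋) (u j - ⌊u j⌋ + ⌊u i⌋)
        ⟨by linarith, by linarith⟩ ?_
      have : u j - ⌊u j⌋ + ⌊u i⌋ + ((⌊u j⌋ - ⌊u i⌋ : ℤ) : ℝ) = u j := by push_cast; ring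
      rw [this]
      exact ⟨le_rfl, huv j hj⟩
    · refine hd i hi j hj hij (⌊u j⌋ - ⌊u i⌋) (u i) ⟨le_rfl, huv i hi⟩ ?_
      push_cast
      exact ⟨by linarith, by linarith⟩

/-! ### Denjoy's theorem -/

/-- The logarithm of the mean slope of `F` on `[a, b]`. -/
noncomputable def logSlope (F : ℝ → ℝ) (a b : ℝ) : ℝ := Real.log ((F b - F a) / (b - a))

/-- The distortion of `F` on subintervals of `[0, 2]` is controlled by the increments of a monotone
function. -/
def HasBoundedDistortion (F : ℝ → ℝ) : Prop :=
  ∃ W : ℝ → ℝ, MonotoneOn W (Icc 0 2) ∧ ∀ u v a b c d : ℝ, 0 ≤ u → v ≤ 2 →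
    u ≤ a → a < b → b ≤ v → u ≤ c → c < d → d ≤ v →
      logSlope F a b - logSlope F c d ≤ W v - W u

theorem map_add_intCast {h : ℝ → ℝ} (h1 : ∀ x, h (x + 1) = h x + 1) (x : ℝ) (m : ℤ) :
    h (x + m) = h x + m := by
  induction m using Int.induction_on with
  | zero => simp
  | succ n ih =>
    push_cast at ih ⊢
    rw [← add_assoc, h1, ih, add_assoc]
  | pred n ih =>
    push_cast at ih ⊢
    have := h1 (x + (-n - 1))
    rw [show x + (-(n : ℝ) - 1) + 1 = x + -n by ring, ih] at this
    linarith

theorem logSlope_add_int {F : ℝ → ℝ} (h1 : ∀ x, F (x + 1) = F x + 1) (a b : ℝ) (m : ℤ) :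
    logSlope F (a + m) (b + m) = logSlope F a b := by
  simp [logSlope, map_add_intCast h1]

section Wandering

variable {F h : ℝ → ℝ} {α c : ℝ} {x y : ℤ → ℝ}

theorem length_le_one_of_semiconj (hmono : Monotone h) (h1 : ∀ x, h (x + 1) = h x + 1) {a b d : ℝ}
    (hd : d < 1) (hab : h b ≤ h a + d) : b ≤ a + 1 := by
  by_contra! hlt
  have := hmono hlt.le
  rw [h1] at this
  linarith

/-- On the `k`-th interval `h` is constantly `c + kα`. These values are distinct modulo 1, so the
intervals are disjoint modulo 1 and their total length is bounded. -/
theorem summable_wandering (hα : Irrational α) (hmono : Monotone h)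
    (h1 : ∀ x, h (x + 1) = h x + 1) (hxy : ∀ k, x k < y k) (hx : ∀ k : ℤ, h (x k) = c + k * α)
    (hy : ∀ k : ℤ, h (y k) = c + k * α) : Summable fun k => y k - x k := by
  have hconst : ∀ k : ℤ, ∀ z ∈ Icc (x k) (y k), h z = c + k * α := fun k z hz =>
    le_antisymm ((hmono hz.2).trans (hy k).le) ((hx k).symm.le.trans (hmono hz.1))
  refine summable_of_sum_le (c := 2) (fun k => sub_nonneg.2 (hxy k).le) fun s => ?_
  have := sum_sub_le_of_disjoint_mod_one (W := id) (monotone_id.monotoneOn _) s x y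
    (fun k _ => (hxy k).le)
    (fun k _ => length_le_one_of_semiconj hmono h1 zero_lt_one (by rw [hx, hy]; simp)) ?_
  · simpa only [id, sub_sub_sub_cancel_right, sub_zero] using this
  · intro i _ j _ hij m z hz hz'
    have e1 := hconst i z hz
    have e2 := hconst j _ hz'
    rw [map_add_intCast h1, e1] at e2
    have hne : i - j ≠ 0 := sub_ne_zero.2 hij
    refine (hα.intCast_mul hne).ne_int (-m) ?_
    push_cast
    linarith

/-- Denjoy's inequality. Write I_k for `[x k, y k]`. The log slopes telescope along I_0, …, I_{q-1}
and along I_{-q}, …, I_{-1}. The slopes on I_k and on I_{k-q} + p are compared inside the hull `[u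
k, v k]` of these two intervals, whose ends have `h`-values `|qα - p|` apart. Hulls with indices i <
j < q that met modulo 1 would give |(j - i)α - m| ≤ |qα - p| for some integer m, against best
approximation. So the distortions add up to at most `W 2 - W 0`. -/
theorem log_wandering_bound (h1F : ∀ x, F (x + 1) = F x + 1) {W : ℝ → ℝ}
    (hW : MonotoneOn W (Icc 0 2))
    (hFW : ∀ u v a b c d : ℝ, 0 ≤ u → v ≤ 2 → u ≤ a → a < b → b ≤ v → u ≤ c → c < d → d ≤ v →
      logSlope F a b - logSlope F c d ≤ W v - W u)
    (hmono : Monotone h) (h1 : ∀ x, h (x + 1) = h x + 1) (hxy : ∀ k, x k < y k)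
    (hx : ∀ k : ℤ, h (x k) = c + k * α) (hy : ∀ k : ℤ, h (y k) = c + k * α)
    (hFx : ∀ k, F (x k) = x (k + 1)) (hFy : ∀ k, F (y k) = y (k + 1))
    {q : ℕ} {p : ℤ} (hqp : |q * α - p| < 1)
    (hbest : ∀ j : ℕ, 0 < j → j < q → ∀ m : ℤ, |q * α - p| < |j * α - m|) :
    2 * Real.log (y 0 - x 0) - (W 2 - W 0) ≤
      Real.log (y q - x q) + Real.log (y (-q) - x (-q)) := by
  have hslope : ∀ k, logSlope F (x k) (y k) =
      Real.log (y (k + 1) - x (k + 1)) - Real.log (y k - x k) := fun k => by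
    rw [logSlope, hFx, hFy, Real.log_div (sub_pos.2 (hxy _)).ne' (sub_pos.2 (hxy _)).ne']
  have s1 : ∑ k ∈ Finset.range q, logSlope F (x k) (y k) =
      Real.log (y q - x q) - Real.log (y 0 - x 0) := by
    have := Finset.sum_range_sub (fun k : ℕ => Real.log (y k - x k)) q
    simpa [hslope] using this
  have s2 : ∑ k ∈ Finset.range q, logSlope F (x (k - q)) (y (k - q)) =
      Real.log (y 0 - x 0) - Real.log (y (-q) - x (-q)) := by
    have := Finset.sum_range_sub (fun k : ℕ => Real.log (y (k - q) - x (k - q))) q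
    simp only [sub_self, Nat.cast_zero, zero_sub] at this
    rw [← this]
    refine Finset.sum_congr rfl fun k _ => ?_
    rw [hslope]
    push_cast
    rw [show (k : ℤ) - q + 1 = k + 1 - q by ring]
  set u : ℕ → ℝ := fun k => min (x k) (x (k - q) + p)
  set v : ℕ → ℝ := fun k => max (y k) (y (k - q) + p)
  have hu : ∀ k : ℕ, h (u k) = c + k * α - max 0 (q * α - p) := fun k => by
    rw [hmono.map_min, map_add_intCast h1, hx, hx]
    push_cast
    rcases le_total 0 (q * α - p) with hs | hs
    · rw [max_eq_right hs, min_eq_right (by linarith)]; ring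
    · rw [max_eq_left hs, min_eq_left (by linarith)]; ring
  have hv : ∀ k : ℕ, h (v k) = h (u k) + |q * α - p| := fun k => by
    rw [hu, hmono.map_max, map_add_intCast h1, hy, hy]
    push_cast
    rcases le_total 0 (q * α - p) with hs | hs
    · rw [max_eq_right hs, max_eq_left (by linarith), abs_of_nonneg hs]; ring
    · rw [max_eq_left hs, max_eq_right (by linarith), abs_of_nonpos hs]; ring
  have huv : ∀ k, u k ≤ v k := fun k =>
    (min_le_left _ _).trans ((hxy _).le.trans (le_max_left _ _))
  have hlen : ∀ k, v k ≤ u k + 1 := fun k =>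
    length_le_one_of_semiconj hmono h1 hqp (hv k).le
  have hsum := sum_sub_le_of_disjoint_mod_one hW (Finset.range q) u v (fun k _ => huv k)
    (fun k _ => hlen k) ?_
  · have key : ∀ k ∈ Finset.range q,
        logSlope F (x (k - q)) (y (k - q)) - logSlope F (x k) (y k) ≤
          W (v k - ⌊u k⌋) - W (u k - ⌊u k⌋) := by
      intro k _
      rw [← logSlope_add_int h1F (x (k - q)) (y (k - q)) (p - ⌊u k⌋),
        ← logSlope_add_int h1F (x k) (y k) (-⌊u k⌋)]
      have a1 : u k ≤ x k := min_le_left _ _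
      have a2 : u k ≤ x (k - q) + p := min_le_right _ _
      have a3 : y k ≤ v k := le_max_left _ _
      have a4 : y (k - q) + p ≤ v k := le_max_right _ _
      have a5 := hxy k
      have a6 := hxy (k - q)
      have a7 := hlen k
      have a8 := Int.floor_le (u k)
      have a9 := Int.lt_floor_add_one (u k)
      push_cast
      apply hFW <;> linarith
    have := (Finset.sum_le_sum key).trans hsum
    rw [Finset.sum_sub_distrib, s1, s2] at this
    linarith
  · have main : ∀ i j : ℕ, i < j → j < q → ∀ m : ℤ, ∀ z z' : ℝ, z' = z + m →
        z ∈ Icc (u i) (v i) → z' ∈ Icc (u j) (v j) → False := by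
      intro i j hij hjq m z z' hzz hz hz'
      have b1 := hmono hz.1
      have b2 := hmono hz.2
      have b3 := hmono hz'.1
      have b4 := hmono hz'.2
      rw [hv] at b2 b4
      rw [hu] at b1 b2 b3 b4
      rw [hzz, map_add_intCast h1] at b3 b4
      have := hbest (j - i) (by omega) (by omega) m
      rw [Nat.cast_sub hij.le] at this
      refine absurd this (not_lt.2 (abs_le.2 ⟨?_, ?_⟩)) <;> linarith
    intro i hi j hj hij m z hz hz'
    rw [Finset.mem_range] at hi hj
    rcases hij.lt_or_gt with hlt | hlt
    · exact main i j hlt hj m z _ rfl hz hz'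
    · exact main j i hlt hi (-m) _ z (by push_cast; ring) hz' hz

theorem not_wandering (hα : Irrational α) (h1F : ∀ x, F (x + 1) = F x + 1)
    (hF : HasBoundedDistortion F)
    (hmono : Monotone h) (h1 : ∀ x, h (x + 1) = h x + 1) (hxy : ∀ k, x k < y k)
    (hx : ∀ k : ℤ, h (x k) = c + k * α) (hy : ∀ k : ℤ, h (y k) = c + k * α)
    (hFx : ∀ k, F (x k) = x (k + 1)) (hFy : ∀ k, F (y k) = y (k + 1)) : False := by
  obtain ⟨W, hW, hFW⟩ := hF
  have hlim := (summable_wandering hα hmono h1 hxy hx hy).tendsto_cofinite_zero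
  -- Chosen so that 2 log ε is the lower bound of `log_wandering_bound`.
  set ε := Real.exp (Real.log (y 0 - x 0) - (W 2 - W 0) / 2) with hε
  have hev := hlim.eventually (gt_mem_nhds (Real.exp_pos _ : 0 < ε))
  have e1 : ∀ᶠ n : ℕ in atTop, y n - x n < ε := by
    rw [← Nat.cofinite_eq_atTop]
    exact (Nat.cast_injective (R := ℤ)).tendsto_cofinite.eventually hev
  have e2 : ∀ᶠ n : ℕ in atTop, y (-n) - x (-n) < ε := by
    rw [← Nat.cofinite_eq_atTop]
    exact (neg_injective.comp (Nat.cast_injective (R := ℤ))).tendsto_cofinite.eventually hev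
  obtain ⟨N, hN⟩ := eventually_atTop.1 (e1.and e2)
  obtain ⟨q, hq, p, hqp, hbest⟩ := exists_best_approximation hα N
  have hb := log_wandering_bound h1F hW hFW hmono h1 hxy hx hy hFx hFy hqp hbest
  obtain ⟨l1, l2⟩ := hN q hq.le
  have l1' := Real.log_lt_log (sub_pos.2 (hxy _)) l1
  have l2' := Real.log_lt_log (sub_pos.2 (hxy _)) l2
  rw [hε, Real.log_exp] at l1' l2'
  linarith

end Wandering

theorem map_zpow_of_semiconj {F : ℝ ≃o ℝ} {h : ℝ → ℝ} {α : ℝ} (hsemi : ∀ x, h (F x) = h x + α)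
    (k : ℤ) (z : ℝ) : h ((F ^ k) z) = h z + k * α := by
  induction k using Int.induction_on with
  | zero => simp
  | succ n ih =>
    rw [add_comm, zpow_add, zpow_one, RelIso.mul_apply, hsemi, ih]
    push_cast; ring
  | pred n ih =>
    have := hsemi ((F ^ (-(n : ℤ) - 1)) z)
    rw [← RelIso.mul_apply, ← zpow_one_add, show (1 + (-(n : ℤ) - 1)) = -n by ring, ih] at this
    push_cast at this ⊢
    linarith

/-- **Denjoy's theorem**: for a lift with bounded distortion, a semiconjugacy to an irrational
translation is injective. -/
theorem strictMono_of_semiconj {F : ℝ ≃o ℝ} (h1F : ∀ x, F (x + 1) = F x + 1)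
    (hF : HasBoundedDistortion F) {α : ℝ} (hα : Irrational α) {h : ℝ → ℝ} (hmono : Monotone h)
    (h1 : ∀ x, h (x + 1) = h x + 1) (hsemi : ∀ x, h (F x) = h x + α) : StrictMono h := by
  refine hmono.strictMono_of_injective ?_
  have key : ∀ a b : ℝ, a < b → h a = h b → False := by
    intro a b hab heq
    have hF' : ∀ (z : ℝ) (k : ℤ), F ((F ^ k) z) = (F ^ (k + 1)) z := fun z k => by
      rw [← RelIso.mul_apply, ← zpow_one_add, add_comm]
    exact not_wandering (F := F) (x := fun k => (F ^ k) a) (y := fun k => (F ^ k) b) hα h1F hF hmono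
      h1 (fun k => (F ^ k).strictMono hab) (fun k => map_zpow_of_semiconj hsemi k a)
      (fun k => by rw [heq, map_zpow_of_semiconj hsemi])
      (hF' a) (hF' b)
  intro a b heq
  rcases lt_trichotomy a b with hlt | rfl | hlt
  · exact (key a b hlt heq).elim
  · rfl
  · exact (key b a hlt heq.symm).elim

/-! ### Groups of homeomorphisms of the line containing a dense group of translations -/

section Line

variable {Γ : Subgroup (ℝ ≃o ℝ)}

/-- The group of those `t` for which `Γ` contains the translation by `t`. -/
def translations (Γ : Subgroup (ℝ ≃o ℝ)) : AddSubgroup ℝ where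
  carrier := {t | OrderIso.addRight t ∈ Γ}
  zero_mem' := by
    have : OrderIso.addRight (0 : ℝ) = 1 := by ext; simp
    simp [this, Γ.one_mem]
  add_mem' := by
    intro s t hs ht
    have : OrderIso.addRight (s + t) = OrderIso.addRight t * OrderIso.addRight s := by
      ext x; simp [RelIso.mul_apply, add_assoc]
    change OrderIso.addRight (s + t) ∈ Γ
    rw [this]
    exact Γ.mul_mem ht hs
  neg_mem' := by
    intro t ht
    have : OrderIso.addRight (-t) = (OrderIso.addRight t)⁻¹ := by
      rw [eq_inv_iff_mul_eq_one]; ext x; simp [RelIso.mul_apply]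
    change OrderIso.addRight (-t) ∈ Γ
    rw [this]
    exact Γ.inv_mem ht

/-- Elements of `Γ` map `[x, y]` to arbitrarily short intervals. -/
def Contractible (Γ : Subgroup (ℝ ≃o ℝ)) (x y : ℝ) : Prop :=
  ∀ ε > 0, ∃ γ ∈ Γ, γ y - γ x < ε

theorem Contractible.mono {x y x' y' : ℝ} (h : Contractible Γ x y) (hx : x ≤ x') (hy : y' ≤ y) :
    Contractible Γ x' y' := fun ε hε => by
  obtain ⟨γ, hγ, hlt⟩ := h ε hε
  exact ⟨γ, hγ, by linarith [γ.monotone hx, γ.monotone hy]⟩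

theorem Contractible.image {x y : ℝ} (h : Contractible Γ x y) {f : ℝ ≃o ℝ} (hf : f ∈ Γ) :
    Contractible Γ (f x) (f y) := fun ε hε => by
  obtain ⟨γ, hγ, hlt⟩ := h ε hε
  exact ⟨γ * f⁻¹, Γ.mul_mem hγ (Γ.inv_mem hf), by
    simpa only [RelIso.mul_apply, RelIso.inv_apply_self] using hlt⟩

theorem Contractible.lt_add_one (h1 : ∀ γ ∈ Γ, ∀ x, γ (x + 1) = γ x + 1) {x y : ℝ}
    (h : Contractible Γ x y) : y < x + 1 := by
  by_contra! hle
  obtain ⟨γ, hγ, hlt⟩ := h 1 one_pos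
  have := γ.monotone hle
  rw [h1 γ hγ] at this
  linarith

/-- An interval shorter than a contractible one is contractible. -/
theorem Contractible.of_length_lt (hD : Dense (translations Γ : Set ℝ)) {x y x' y' : ℝ}
    (h : Contractible Γ x y) (hlt : y' - x' < y - x) : Contractible Γ x' y' := by
  -- A translation in Γ slides the shorter interval into the contractible one.
  obtain ⟨t, ht, htx, hty⟩ := hD.exists_between (show x - x' < y - y' by linarith)
  have h' := (h.mono (x' := x' + t) (y' := y' + t) (by linarith) (by linarith)).image
    (Γ.inv_mem (show OrderIso.addRight t ∈ Γ from ht))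
  have e : ∀ z : ℝ, (OrderIso.addRight t)⁻¹ (z + t) = z := fun z =>
    RelIso.inv_apply_self (OrderIso.addRight t) z
  rwa [e, e] at h'

/-- Pick a translation `t` in Γ with `f x < x + t` and `y + t < f y`. If Γ could not shrink `[y + t,
f y]` below ε, take γ with `γ y - γ x` within ε of its supremum. Precomposing γ with translation by
`-t` and then with `f` adds at least ε to this difference and so exceeds the supremum. -/
theorem exists_contractible_of_expanding (h1 : ∀ γ ∈ Γ, ∀ x, γ (x + 1) = γ x + 1)
    (hD : Dense (translations Γ : Set ℝ)) {f : ℝ ≃o ℝ} (hf : f ∈ Γ) {x y : ℝ}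
    (hlt : y - x < f y - f x) : ∃ a b : ℝ, a < b ∧ Contractible Γ a b := by
  obtain ⟨t, ht, htx, hty⟩ := hD.exists_between (show f x - x < f y - y by linarith)
  refine ⟨y + t, f y, by linarith, fun ε hε => ?_⟩
  by_contra! hcon
  set S := (fun γ : ℝ ≃o ℝ => γ y - γ x) '' (Γ : Set (ℝ ≃o ℝ))
  have hne : S.Nonempty := ⟨_, 1, Γ.one_mem, rfl⟩
  have hbdd : BddAbove S := by
    refine ⟨(⌈y - x⌉ : ℝ), ?_⟩
    rintro _ ⟨γ, hγ, rfl⟩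
    have h2 : γ y ≤ γ (x + ⌈y - x⌉) := γ.monotone (by linarith [Int.le_ceil (y - x)])
    rw [map_add_intCast (h1 γ hγ)] at h2
    simp only
    linarith
  obtain ⟨_, ⟨γ, hγ, rfl⟩, hγS⟩ := exists_lt_of_lt_csSup hne (sub_lt_self (sSup S) hε)
  set γ' := γ * (OrderIso.addRight t)⁻¹
  have hγ' : γ' ∈ Γ := Γ.mul_mem hγ (Γ.inv_mem ht)
  have e : ∀ z : ℝ, γ' (z + t) = γ z := fun z =>
    congrArg γ (RelIso.inv_apply_self (OrderIso.addRight t) z)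
  have k1 := hcon γ' hγ'
  have k2 : γ' (f y) - γ' (f x) ≤ sSup S := le_csSup hbdd ⟨γ' * f, Γ.mul_mem hγ' hf, rfl⟩
  have k3 : γ' (f x) ≤ γ' (x + t) := γ'.monotone (by linarith)
  rw [e] at k1 k3
  simp only at hγS
  linarith

theorem exists_contractible (h1 : ∀ γ ∈ Γ, ∀ x, γ (x + 1) = γ x + 1)
    (hD : Dense (translations Γ : Set ℝ)) (hnot : ¬ ∀ γ ∈ Γ, ∀ x, γ x = x + γ 0) :
    ∃ a b : ℝ, a < b ∧ Contractible Γ a b := by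
  push Not at hnot
  obtain ⟨f, hf, z, hz⟩ := hnot
  have main : ∀ x y : ℝ, f y - f x ≠ y - x → ∃ a b : ℝ, a < b ∧ Contractible Γ a b := by
    intro x y hne
    rcases hne.lt_or_gt with hlt | hlt
    · refine exists_contractible_of_expanding h1 hD (Γ.inv_mem hf) (x := f x) (y := f y) ?_
      rwa [RelIso.inv_apply_self, RelIso.inv_apply_self]
    · exact exists_contractible_of_expanding h1 hD hf hlt
  exact main 0 z fun h => hz (by linarith)

/-- The supremal length of contractible intervals is a common period of `Γ`. -/
theorem exists_period (h1 : ∀ γ ∈ Γ, ∀ x, γ (x + 1) = γ x + 1)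
    (hD : Dense (translations Γ : Set ℝ)) (hnot : ¬ ∀ γ ∈ Γ, ∀ x, γ x = x + γ 0) :
    ∃ L : ℝ, 0 < L ∧ (∃ n : ℤ, 1 = n * L) ∧ (∀ γ ∈ Γ, ∀ x, γ (x + L) = γ x + L) ∧
      ∀ x y, y - x < L → Contractible Γ x y := by
  obtain ⟨a, b, hab, hc⟩ := exists_contractible h1 hD hnot
  set S : Set ℝ := {l | ∃ x y, l = y - x ∧ Contractible Γ x y}
  have hbdd : BddAbove S := ⟨1, by
    rintro _ ⟨x, y, rfl, h⟩; linarith [h.lt_add_one h1]⟩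
  have hmem : b - a ∈ S := ⟨a, b, rfl, hc⟩
  set L := sSup S
  have hL : 0 < L := lt_of_lt_of_le (sub_pos.2 hab) (le_csSup hbdd hmem)
  have hle : ∀ x y, Contractible Γ x y → y - x ≤ L := fun x y h => le_csSup hbdd ⟨x, y, rfl, h⟩
  have hcontr : ∀ x y, y - x < L → Contractible Γ x y := by
    intro x y hlt
    obtain ⟨_, ⟨x', y', rfl, h⟩, hlt'⟩ := exists_lt_of_lt_csSup ⟨_, hmem⟩ hlt
    exact h.of_length_lt hD hlt'
  -- If γ stretched `[x, x + L]`, then some `[x, y]` with `y < x + L` would be contractible with an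
  -- image longer than L.
  have hexp : ∀ γ ∈ Γ, ∀ x, γ (x + L) ≤ γ x + L := by
    intro γ hγ x
    by_contra! hlt
    have hy : γ.symm (γ x + L) < x + L := by
      rw [← γ.lt_iff_lt, OrderIso.apply_symm_apply]; exact hlt
    obtain ⟨y, hy1, hy2⟩ := exists_between hy
    have h3 : γ x + L < γ y := by
      rw [← γ.lt_iff_lt, OrderIso.apply_symm_apply] at hy1; exact hy1
    have := hle _ _ ((hcontr x y (by linarith)).image hγ)
    linarith
  have hper : ∀ γ ∈ Γ, ∀ x, γ (x + L) = γ x + L := by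
    intro γ hγ x
    refine le_antisymm (hexp γ hγ x) ?_
    have := hexp γ⁻¹ (Γ.inv_mem hγ) (γ x)
    rw [RelIso.inv_apply_self] at this
    have h2 := γ.monotone this
    rwa [RelIso.apply_inv_self] at h2
  refine ⟨L, hL, ⟨⌊1 / L⌋, ?_⟩, hper, hcontr⟩
  -- Were 1 not a multiple of L, the remainder `[⌊1 / L⌋ * L, 1]` would be contractible. But Γ
  -- commutes with translation by L and by 1, so it preserves the length of this interval.
  have hperZ : ∀ γ ∈ Γ, ∀ n : ℕ, γ (n * L) = γ 0 + n * L := by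
    intro γ hγ n
    induction n with
    | zero => simp
    | succ n ih => push_cast; rw [add_mul, one_mul, hper γ hγ, ih]; ring
  have hfl : ((⌊1 / L⌋₊ : ℕ) : ℝ) = (⌊1 / L⌋ : ℝ) := natCast_floor_eq_intCast_floor (by positivity)
  have f1 := Int.floor_le (1 / L)
  have f2 := Int.lt_floor_add_one (1 / L)
  rw [le_div_iff₀ hL] at f1
  rw [div_lt_iff₀ hL] at f2
  by_contra hne
  have hlt : (⌊1 / L⌋ : ℝ) * L < 1 := lt_of_le_of_ne f1 (Ne.symm hne)
  obtain ⟨γ, hγ, hγlt⟩ := hcontr (⌊1 / L⌋ * L) 1 (by linarith) (1 - ⌊1 / L⌋ * L) (by linarith)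
  have e1 := h1 γ hγ 0
  have e2 := hperZ γ hγ ⌊1 / L⌋₊
  rw [hfl] at e2
  rw [zero_add] at e1
  linarith

/-- The complement of the `L`-periodic family of intervals starting at `s` is mapped into the one
starting at `t`. -/
theorem exists_proximal (hD : Dense (translations Γ : Set ℝ)) {L : ℝ}
    (hper : ∀ γ ∈ Γ, ∀ x, γ (x + L) = γ x + L) (hL : 0 < L)
    (hcontr : ∀ x y, y - x < L → Contractible Γ x y) {ε : ℝ} (hε : 0 < ε) (s t : ℝ) :
    ∃ γ ∈ Γ, ∀ y : ℝ, (¬ ∃ k : ℤ, y - k * L ∈ Icc s (s + ε)) →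
      ∃ k : ℤ, γ y - k * L ∈ Icc t (t + ε) := by
  -- The gap `[s + ε, s + L]` is shorter than L. Some γ shrinks it below ε, and a translation then
  -- moves the image into the target.
  obtain ⟨γ, hγ, hlt⟩ := hcontr (s + ε) (s + L) (by linarith) ε hε
  obtain ⟨v, hv, hv1, hv2⟩ := hD.exists_between
    (show t - γ (s + ε) < t + ε - γ (s + L) by linarith)
  have hγ' : OrderIso.addRight v * γ ∈ Γ := Γ.mul_mem hv hγ
  refine ⟨_, hγ', fun y hy => ⟨⌊(y - s) / L⌋, ?_⟩⟩
  have f1 := Int.floor_le ((y - s) / L)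
  have f2 := Int.lt_floor_add_one ((y - s) / L)
  rw [le_div_iff₀ hL] at f1
  rw [div_lt_iff₀ hL] at f2
  set k := ⌊(y - s) / L⌋
  have hper' : γ y = γ (y - k * L) + k * L := by
    have hq : ∀ z, (fun w => γ (w * L) / L) (z + 1) = (fun w => γ (w * L) / L) z + 1 := by
      intro z
      simp only
      rw [add_mul, one_mul, hper γ hγ]
      field_simp
    have := map_add_intCast (h := fun w => γ (w * L) / L) hq ((y - k * L) / L) k
    simp only [add_mul, div_mul_cancel₀ _ hL.ne', sub_add_cancel] at this
    field_simp at this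
    rwa [mul_comm L] at this
  have hy' : s + ε < y - k * L := by
    by_contra! hle
    exact hy ⟨k, by linarith, hle⟩
  have m1 := γ.monotone hy'.le
  have m2 : γ (y - k * L) ≤ γ (s + L) := γ.monotone (by linarith)
  rw [RelIso.mul_apply, OrderIso.addRight_apply, hper']
  exact ⟨by linarith, by linarith⟩

end Line

/-! ### Free subgroups of groups of circle homeomorphisms -/

theorem hasNonabelianFreeSubgroup_of_injective {G : Subgroup homeoPlus}
    (φ : FreeGroup (Fin 2) →* homeoPlus) (hφ : Function.Injective φ) (hG : ∀ w, φ w ∈ G) :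
    HasNonabelianFreeSubgroup G := by
  refine ⟨φ.range, ?_, IsFreeGroup.ofMulEquiv (MonoidHom.ofInjective hφ), φ (FreeGroup.of 0),
    ⟨_, rfl⟩, φ (FreeGroup.of 1), ⟨_, rfl⟩, ?_⟩
  · rintro _ ⟨w, rfl⟩
    exact hG w
  · rw [← map_mul, ← map_mul]
    exact hφ.ne (by decide)

/-- All lifts of the elements of `G`. -/
def liftGroup (G : Subgroup homeoPlus) : Subgroup (ℝ ≃o ℝ) where
  carrier := {F | ∃ g ∈ G, IsLift F g}
  mul_mem' := by
    rintro F K ⟨f, hf, hF⟩ ⟨g, hg, hK⟩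
    refine ⟨f * g, G.mul_mem hf hg, fun x => ?_⟩
    change ((F (K x) : ℝ) : UnitAddCircle) = f.1 (g.1 x)
    rw [hF, hK]
  one_mem' := ⟨1, G.one_mem, fun _ => rfl⟩
  inv_mem' := by
    rintro F ⟨f, hf, hF⟩
    refine ⟨f⁻¹, G.inv_mem hf, fun x => ?_⟩
    change ((F.symm x : ℝ) : UnitAddCircle) = f.1.symm x
    rw [Homeomorph.eq_symm_apply, ← hF, OrderIso.apply_symm_apply]

theorem map_add_one_of_mem_liftGroup {G : Subgroup homeoPlus} {γ : ℝ ≃o ℝ} (hγ : γ ∈ liftGroup G)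
    (x : ℝ) : γ (x + 1) = γ x + 1 := by
  obtain ⟨g, -, h⟩ := hγ
  exact h.map_add_one x

/-- The points of the circle over the `L`-periodic family of intervals of length `L / 8` that starts
at `i * L / 4`. -/
def pingPongSet (L : ℝ) (i : ℕ) : Set UnitAddCircle :=
  {z | ∃ y : ℝ, (y : UnitAddCircle) = z ∧ ∃ k : ℤ, y - k * L ∈ Icc (i * L / 4) (i * L / 4 + L / 8)}

/-- A common point would force the integer `z`, congruent to `i - j` modulo 4, to satisfy |z| ≤ 1/2.
The relation `1 = n * L` makes integer shifts multiples of L. -/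
theorem disjoint_pingPongSet {L : ℝ} (hL : 0 < L) {n : ℤ} (hn : 1 = n * L) {i j : ℕ} (hi : i < 4)
    (hj : j < 4) (hij : i ≠ j) : Disjoint (pingPongSet L i) (pingPongSet L j) := by
  rw [Set.disjoint_left]
  rintro _ ⟨y, rfl, k, hk1, hk2⟩ ⟨y', hy', k', hk1', hk2'⟩
  obtain ⟨m, hm⟩ := coe_eq_coe_iff.1 hy'
  have hm' : (m : ℝ) = m * n * L := by rw [mul_assoc, ← hn, mul_one]
  set z : ℤ := (i : ℤ) - j + 4 * (k - k' + m * n) with hz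
  have e : (z : ℝ) * L = i * L - j * L + 4 * (k * L - k' * L + m) := by
    rw [hm', hz]; push_cast; ring
  have b1 : (z : ℝ) * L ≤ (1 / 2) * L := by rw [e]; linarith
  have b2 : (-(1 / 2)) * L ≤ (z : ℝ) * L := by rw [e]; linarith
  have c1 : (z : ℝ) < 1 := by linarith [le_of_mul_le_mul_right b1 hL]
  have c2 : (-1 : ℝ) < z := by linarith [le_of_mul_le_mul_right b2 hL]
  have c1' : z < 1 := by exact_mod_cast c1
  have c2' : -1 < z := by exact_mod_cast c2
  omega

theorem nonempty_pingPongSet {L : ℝ} (hL : 0 < L) (i : ℕ) : (pingPongSet L i).Nonempty :=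
  ⟨((i * L / 4 : ℝ) : UnitAddCircle), i * L / 4, rfl, 0, by
    rw [Int.cast_zero, zero_mul, sub_zero]
    exact ⟨le_rfl, by linarith⟩⟩

theorem exists_pingPong {G : Subgroup homeoPlus} (hD : Dense (translations (liftGroup G) : Set ℝ))
    {L : ℝ} (hL : 0 < L) (hper : ∀ γ ∈ liftGroup G, ∀ x, γ (x + L) = γ x + L)
    (hcontr : ∀ x y, y - x < L → Contractible (liftGroup G) x y) (i j : ℕ) :
    ∃ g ∈ G, ∀ z, z ∉ pingPongSet L i → g.1 z ∈ pingPongSet L j := by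
  obtain ⟨γ, ⟨g, hg, hlift⟩, hγ⟩ := exists_proximal hD hper hL hcontr
    (show 0 < L / 8 by positivity) (i * L / 4) (j * L / 4)
  refine ⟨g, hg, fun z hz => ?_⟩
  obtain ⟨y, rfl⟩ := QuotientAddGroup.mk_surjective z
  exact ⟨γ y, hlift y, hγ y fun hk => hz ⟨y, rfl, hk⟩⟩

theorem exists_injective_freeGroup {G : Subgroup homeoPlus}
    (hD : Dense (translations (liftGroup G) : Set ℝ))
    (hnot : ¬ ∀ γ ∈ liftGroup G, ∀ x, γ x = x + γ 0) :
    ∃ φ : FreeGroup (Fin 2) →* homeoPlus, Function.Injective φ ∧ ∀ w, φ w ∈ G := by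
  obtain ⟨L, hL, ⟨n, hn⟩, hper, hcontr⟩ :=
    exists_period (fun γ hγ => map_add_one_of_mem_liftGroup hγ) hD hnot
  -- Sets 0 and 1 attract; sets 2 and 3 repel.
  have hex : ∀ i : Fin 2, ∃ g ∈ G, ∀ z, z ∉ pingPongSet L (i + 2) → g.1 z ∈ pingPongSet L i :=
    fun i => exists_pingPong hD hL hper hcontr _ _
  choose a ha hap using hex
  let _ : MulAction homeoPlus UnitAddCircle :=
    { smul := fun g z => g.1 z
      one_smul := fun _ => rfl
      mul_smul := fun _ _ _ => rfl }
  have hdisj : ∀ {i j : ℕ}, i < 4 → j < 4 → i ≠ j →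
      Disjoint (pingPongSet L i) (pingPongSet L j) := disjoint_pingPongSet hL hn
  refine ⟨FreeGroup.lift a, ?_, fun w => ?_⟩
  · refine FreeGroup.injective_lift_of_ping_pong a (fun i => pingPongSet L i)
      (fun i => pingPongSet L (i + 2)) (fun i => nonempty_pingPongSet hL _)
      (fun i j hij => hdisj (by omega) (by omega) (Fin.val_ne_of_ne hij))
      (fun i j hij => hdisj (by omega) (by omega) (by have := Fin.val_ne_of_ne hij; omega))
      (fun i j => hdisj (by omega) (by omega) (by omega)) ?_ ?_
    · rintro i _ ⟨z, hz, rfl⟩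
      exact hap i z hz
    · rintro i _ ⟨z, hz, rfl⟩
      by_contra hcon
      have h := hap i _ hcon
      change (a i) • ((a i)⁻¹ • z) ∈ _ at h
      rw [smul_inv_smul] at h
      exact hz h
  · have h : (FreeGroup.lift a).range ≤ G := by
      rw [FreeGroup.range_lift_eq_closure, Subgroup.closure_le]
      rintro _ ⟨i, rfl⟩
      exact ha i
    exact h ⟨w, rfl⟩

/-! ### Bounded distortion -/

theorem IsLift.symm {F : ℝ ≃o ℝ} {f : UnitAddCircle ≃ₜ UnitAddCircle} (hF : IsLift F f) :
    IsLift F.symm f.symm := fun x => by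
  rw [Homeomorph.eq_symm_apply, ← hF, OrderIso.apply_symm_apply]

/-- By the mean value theorem, mean slopes are values of the derivative. With the Jordan
decomposition log F' = P - Q, the function P + Q controls the distortion. -/
theorem hasBoundedDistortion_of_deriv {F : ℝ → ℝ} (hF : Differentiable ℝ F)
    (hlog : BoundedVariationOn (fun x => Real.log (deriv F x)) (Icc 0 2)) :
    HasBoundedDistortion F := by
  obtain ⟨P, Q, hP, hQ, hPQ⟩ := hlog.locallyBoundedVariationOn.exists_monotoneOn_sub_monotoneOn
  refine ⟨P + Q, hP.add hQ, fun u v a b c d hu hv ha hab hb hc hcd hd => ?_⟩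
  have mvt : ∀ a b, a < b → u ≤ a → b ≤ v → ∃ ξ, u ≤ ξ ∧ ξ ≤ v ∧ logSlope F a b = P ξ - Q ξ := by
    intro a b hab ha hb
    obtain ⟨ξ, hξ, h⟩ := exists_deriv_eq_slope F hab hF.continuous.continuousOn
      hF.differentiableOn
    refine ⟨ξ, ha.trans hξ.1.le, hξ.2.le.trans hb, ?_⟩
    rw [logSlope, ← h]
    exact congrFun hPQ ξ
  obtain ⟨ξ, h1, h2, e1⟩ := mvt a b hab ha hb
  obtain ⟨η, h3, h4, e2⟩ := mvt c d hcd hc hd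
  have huv : u ≤ v := h1.trans h2
  have mem : ∀ {z}, u ≤ z → z ≤ v → z ∈ Icc (0 : ℝ) 2 := fun h h' => ⟨hu.trans h, h'.trans hv⟩
  have p1 := hP (mem h1 h2) (mem huv le_rfl) h2
  have p2 := hP (mem le_rfl huv) (mem h3 h4) h3
  have q1 := hQ (mem le_rfl huv) (mem h1 h2) h1
  have q2 := hQ (mem h3 h4) (mem huv le_rfl) h4
  rw [e1, e2]
  simp only [Pi.add_apply]
  linarith

theorem boundedVariationOn_Icc_two {φ : ℝ → ℝ} (hper : ∀ x, φ (x + 1) = φ x)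
    (hφ : BoundedVariationOn φ (Icc 0 1)) : BoundedVariationOn φ (Icc 0 2) := by
  have h := eVariationOn.Icc_add_Icc φ (s := univ) zero_le_one one_le_two (mem_univ (1 : ℝ))
  simp only [univ_inter] at h
  have h2 : eVariationOn φ (Icc 1 2) ≤ eVariationOn φ (Icc 0 1) := by
    have e : EqOn φ (φ ∘ fun x => x - 1) (Icc 1 2) := fun x _ => by
      simpa using hper (x - 1)
    rw [eVariationOn.congr e]
    refine eVariationOn.comp_le_of_monotoneOn _ _ (fun x _ y _ hxy => sub_le_sub_right hxy _) ?_
    intro x hx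
    exact ⟨by linarith [hx.1], by linarith [hx.2]⟩
  rw [BoundedVariationOn, ← h]
  exact ENNReal.add_ne_top.2 ⟨hφ, ne_top_of_le_ne_top hφ h2⟩

/-- A differentiable inverse excludes critical points. Then F' is bounded below by a positive
constant on `[0, 2]`, where log is Lipschitz on its values, so log F' inherits bounded variation. -/
theorem hasBoundedDistortion_of_c1bv {F : ℝ ≃o ℝ} (h1 : ∀ x, F (x + 1) = F x + 1)
    (hC : ContDiff ℝ 1 F) (hinv : Differentiable ℝ F.symm)
    (hbv : BoundedVariationOn (deriv F) (Icc 0 1)) : HasBoundedDistortion F := by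
  have hF : Differentiable ℝ F := hC.differentiable one_ne_zero
  have hpos : ∀ x, 0 < deriv F x := by
    intro x
    refine lt_of_le_of_ne F.monotone.deriv_nonneg (Ne.symm ?_)
    intro h0
    have hcomp := (hinv (F x)).hasDerivAt.comp x (hF x).hasDerivAt
    have hid : F.symm ∘ F = id := by ext; simp
    rw [hid, h0, mul_zero] at hcomp
    exact zero_ne_one (hcomp.unique (hasDerivAt_id x))
  have hper : ∀ x, deriv F (x + 1) = deriv F x := by
    intro x
    rw [← deriv_comp_add_const]
    simp only [h1, deriv_add_const]
  refine hasBoundedDistortion_of_deriv hF ?_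
  obtain ⟨x₀, -, hmin⟩ := (isCompact_Icc (a := (0 : ℝ)) (b := 2)).exists_isMinOn
    ⟨0, by simp⟩ (hC.continuous_deriv le_rfl).continuousOn
  have hlip : LipschitzOnWith (Real.toNNReal (deriv F x₀)⁻¹) Real.log (Ici (deriv F x₀)) := by
    refine (convex_Ici _).lipschitzOnWith_of_nnnorm_deriv_le (fun y hy => ?_) fun y hy => ?_
    · exact (Real.differentiableAt_log ((hpos x₀).trans_le hy).ne')
    · rw [Real.deriv_log, ← NNReal.coe_le_coe, coe_nnnorm, Real.coe_toNNReal _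
        (inv_nonneg.2 (hpos x₀).le), Real.norm_of_nonneg (inv_nonneg.2 ((hpos x₀).trans_le hy).le)]
      exact inv_anti₀ (hpos x₀) hy
  exact hlip.comp_boundedVariationOn (fun x hx => hmin hx) (boundedVariationOn_Icc_two hper hbv)

/-- The points near which `F` is not affine. -/
def breaks (F : ℝ → ℝ) : Set ℝ := {x | ¬ ∃ a b : ℝ, ∀ᶠ y in 𝓝 x, F y = a * y + b}

/-- F' is locally constant, hence constant on the open interval; continuity reaches the endpoints.
-/
theorem exists_affine_of_no_breaks {F : ℝ → ℝ} (hF : Continuous F) {u v : ℝ} (huv : u < v)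
    (hno : ∀ x ∈ Ioo u v, x ∉ breaks F) : ∃ a b : ℝ, ∀ x ∈ Icc u v, F x = a * x + b := by
  have hloc : ∀ x ∈ Ioo u v, ∃ a b : ℝ, ∀ᶠ y in 𝓝 x, F y = a * y + b := fun x hx =>
    not_not.1 (hno x hx)
  have hder : ∀ a b y : ℝ, HasDerivAt (fun z => a * z + b) a y := fun a b y => by
    simpa using ((hasDerivAt_id y).const_mul a).add_const b
  have hdiff : ∀ x ∈ Ioo u v, DifferentiableAt ℝ F x := fun x hx => by
    obtain ⟨a, b, h⟩ := hloc x hx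
    exact ((hder a b x).congr_of_eventuallyEq h).differentiableAt
  have hderiv : ∀ x ∈ Ioo u v, HasDerivAt (deriv F) 0 x := fun x hx => by
    obtain ⟨a, b, h⟩ := hloc x hx
    refine (hasDerivAt_const x a).congr_of_eventuallyEq ?_
    filter_upwards [h.eventually_nhds] with y hy
    exact ((hder a b y).congr_of_eventuallyEq hy).deriv
  obtain ⟨w, hw⟩ := nonempty_Ioo.2 huv
  have hconst : ∀ x ∈ Ioo u v, deriv F x = deriv F w := fun x hx =>
    isOpen_Ioo.is_const_of_deriv_eq_zero isPreconnected_Ioo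
      (fun y hy => (hderiv y hy).differentiableAt.differentiableWithinAt)
      (fun y hy => (hderiv y hy).deriv) hx hw
  have hsub : ∀ x ∈ Ioo u v, F x - deriv F w * x = F w - deriv F w * w := fun x hx => by
    have hd : ∀ y ∈ Ioo u v, HasDerivAt (fun z => F z - deriv F w * z) 0 y := fun y hy => by
      have := (hdiff y hy).hasDerivAt.sub ((hasDerivAt_id y).const_mul (deriv F w))
      rwa [hconst y hy, mul_one, sub_self] at this
    exact isOpen_Ioo.is_const_of_deriv_eq_zero isPreconnected_Ioo
      (fun y hy => (hd y hy).differentiableAt.differentiableWithinAt)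
      (fun y hy => (hd y hy).deriv) hx hw
  refine ⟨deriv F w, F w - deriv F w * w, fun x hx => ?_⟩
  have hcl : EqOn F (fun x => deriv F w * x + (F w - deriv F w * w)) (closure (Ioo u v)) := by
    refine EqOn.closure (fun x hx => ?_) hF (by fun_prop)
    have := hsub x hx
    linarith
  rw [closure_Ioo huv.ne] at hcl
  exact hcl hx

/-- Induction on the number of breaks, splitting at one of them; an affine piece has positive slope
by strict monotonicity. -/
theorem exists_bilipschitz {F : ℝ → ℝ} (hF : Continuous F) (hmono : StrictMono F) (u v : ℝ)
    (huv : u < v) (hfin : (breaks F ∩ Ioo u v).Finite) :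
    ∃ m M : ℝ, 0 < m ∧ 0 < M ∧ ∀ a b, u ≤ a → a ≤ b → b ≤ v →
      m * (b - a) ≤ F b - F a ∧ F b - F a ≤ M * (b - a) := by
  induction hn : (breaks F ∩ Ioo u v).ncard using Nat.strong_induction_on generalizing u v with
  | _ n ih =>
  by_cases hno : ∀ x ∈ Ioo u v, x ∉ breaks F
  · obtain ⟨s, t, hst⟩ := exists_affine_of_no_breaks hF huv hno
    have hs : 0 < s := by
      have h1 := hmono huv
      rw [hst u ⟨le_rfl, huv.le⟩, hst v ⟨huv.le, le_rfl⟩] at h1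
      have h2 : 0 < s * (v - u) := by linarith
      exact pos_of_mul_pos_left h2 (sub_pos.2 huv).le
    refine ⟨s, s, hs, hs, fun a b ha hab hb => ?_⟩
    rw [hst a ⟨ha, hab.trans hb⟩, hst b ⟨ha.trans hab, hb⟩]
    constructor <;> linarith
  · push Not at hno
    obtain ⟨w, hw, hwb⟩ := hno
    have hl : breaks F ∩ Ioo u w ⊂ breaks F ∩ Ioo u v :=
      ⟨inter_subset_inter_right _ (Ioo_subset_Ioo_right hw.2.le), fun h =>
        lt_irrefl w (h ⟨hwb, hw⟩).2.2⟩
    have hr : breaks F ∩ Ioo w v ⊂ breaks F ∩ Ioo u v :=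
      ⟨inter_subset_inter_right _ (Ioo_subset_Ioo_left hw.1.le), fun h =>
        lt_irrefl w (h ⟨hwb, hw⟩).2.1⟩
    obtain ⟨m₁, M₁, hm₁, hM₁, h₁⟩ := ih _ (hn ▸ ncard_lt_ncard hl hfin) u w hw.1
      (hfin.subset hl.1) rfl
    obtain ⟨m₂, M₂, hm₂, hM₂, h₂⟩ := ih _ (hn ▸ ncard_lt_ncard hr hfin) w v hw.2
      (hfin.subset hr.1) rfl
    refine ⟨min m₁ m₂, max M₁ M₂, lt_min hm₁ hm₂, lt_max_of_lt_left hM₁,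
      fun a b ha hab hb => ?_⟩
    have weaken : ∀ {m M a b}, a ≤ b → (m = m₁ ∧ M = M₁ ∨ m = m₂ ∧ M = M₂) →
        m * (b - a) ≤ F b - F a ∧ F b - F a ≤ M * (b - a) →
        min m₁ m₂ * (b - a) ≤ F b - F a ∧ F b - F a ≤ max M₁ M₂ * (b - a) := by
      intro m M a b hab hm h
      have hba := sub_nonneg.2 hab
      have e1 : min m₁ m₂ ≤ m := by rcases hm with ⟨rfl, -⟩ | ⟨rfl, -⟩ <;> simp
      have e2 : M ≤ max M₁ M₂ := by rcases hm with ⟨-, rfl⟩ | ⟨-, rfl⟩ <;> simp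
      exact ⟨(mul_le_mul_of_nonneg_right e1 hba).trans h.1,
        h.2.trans (mul_le_mul_of_nonneg_right e2 hba)⟩
    rcases le_total b w with hbw | hwb'
    · exact weaken hab (.inl ⟨rfl, rfl⟩) (h₁ a b ha hab hbw)
    rcases le_total w a with hwa | haw
    · exact weaken hab (.inr ⟨rfl, rfl⟩) (h₂ a b hwa hab hb)
    have k1 := weaken haw (.inl ⟨rfl, rfl⟩) (h₁ a w ha haw le_rfl)
    have k2 := weaken hwb' (.inr ⟨rfl, rfl⟩) (h₂ w b le_rfl hwb' hb)
    constructor <;> linarith [k1.1, k1.2, k2.1, k2.2]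

theorem hasBoundedDistortion_of_finite_breaks {F : ℝ → ℝ} (hF : Continuous F) (hmono : StrictMono F)
    (hfin : (breaks F ∩ Icc 0 2).Finite) : HasBoundedDistortion F := by
  obtain ⟨m, M, hm, hM, hmM⟩ := exists_bilipschitz hF hmono 0 2 two_pos
    (hfin.subset (inter_subset_inter_right _ Ioo_subset_Icc_self))
  have hbd : ∀ a b, 0 ≤ a → a < b → b ≤ 2 →
      Real.log m ≤ logSlope F a b ∧ logSlope F a b ≤ Real.log M := by
    intro a b ha hab hb
    obtain ⟨h1, h2⟩ := hmM a b ha hab.le hb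
    have hba := sub_pos.2 hab
    rw [← le_div_iff₀ hba] at h1
    rw [← div_le_iff₀ hba] at h2
    exact ⟨Real.log_le_log hm h1, Real.log_le_log (hm.trans_le h1) h2⟩
  have hC : 0 ≤ Real.log M - Real.log m := by
    obtain ⟨h1, h2⟩ := hbd 0 2 le_rfl two_pos le_rfl
    linarith
  have hcard : ∀ x y : ℝ, x ≤ y →
      (breaks F ∩ Icc 0 2 ∩ Iio x).ncard ≤ (breaks F ∩ Icc 0 2 ∩ Iio y).ncard := fun x y hxy =>
    ncard_le_ncard (inter_subset_inter_right _ (Iio_subset_Iio hxy)) (hfin.inter_of_left _)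
  -- `W` jumps by the largest possible distortion after each break. Without a break inside `(u, v)`
  -- all slopes agree; a break inside is counted at `v` but not at `u`.
  refine ⟨fun x => (Real.log M - Real.log m) * ((breaks F ∩ Icc 0 2 ∩ Iio x).ncard : ℝ), ?_, ?_⟩
  · intro x _ y _ hxy
    exact mul_le_mul_of_nonneg_left (Nat.cast_le.2 (hcard x y hxy)) hC
  · intro u v a b c d hu hv ha hab hb hc hcd hd
    have huv : u < v := ha.trans_lt (hab.trans_le hb)
    simp only [← mul_sub]
    by_cases hno : ∀ x ∈ Ioo u v, x ∉ breaks F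
    · obtain ⟨s, t, hst⟩ := exists_affine_of_no_breaks hF huv hno
      have hs : ∀ a b, u ≤ a → a < b → b ≤ v → logSlope F a b = Real.log s := by
        intro a b ha hab hb
        rw [logSlope, hst a ⟨ha, hab.le.trans hb⟩, hst b ⟨ha.trans hab.le, hb⟩]
        congr 1
        rw [div_eq_iff (sub_pos.2 hab).ne']
        ring
      rw [hs a b ha hab hb, hs c d hc hcd hd, sub_self]
      exact mul_nonneg hC (sub_nonneg.2 (Nat.cast_le.2 (hcard u v huv.le)))
    · push Not at hno
      obtain ⟨w, hw, hwb⟩ := hno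
      have hlt : (breaks F ∩ Icc 0 2 ∩ Iio u).ncard < (breaks F ∩ Icc 0 2 ∩ Iio v).ncard :=
        ncard_lt_ncard ⟨inter_subset_inter_right _ (Iio_subset_Iio huv.le), fun h =>
          lt_asymm hw.1 (h ⟨⟨hwb, hu.trans hw.1.le, hw.2.le.trans hv⟩, hw.2⟩).2⟩
          (hfin.inter_of_left _)
      have h1 : (1 : ℝ) ≤ ((breaks F ∩ Icc 0 2 ∩ Iio v).ncard : ℝ) -
          ((breaks F ∩ Icc 0 2 ∩ Iio u).ncard : ℝ) := by
        have : (((breaks F ∩ Icc 0 2 ∩ Iio u).ncard + 1 : ℕ) : ℝ) ≤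
            ((breaks F ∩ Icc 0 2 ∩ Iio v).ncard : ℝ) := Nat.cast_le.2 hlt
        push_cast at this
        linarith
      have h2 := le_mul_of_one_le_right hC h1
      have h3 := (hbd a b (hu.trans ha) hab (hb.trans hv)).2
      have h4 := (hbd c d (hu.trans hc) hcd (hd.trans hv)).1
      linarith

theorem mem_breaks_of_add_one {F : ℝ → ℝ} (h1 : ∀ x, F (x + 1) = F x + 1) {x : ℝ}
    (hx : x + 1 ∈ breaks F) : x ∈ breaks F := by
  rintro ⟨a, b, h⟩
  refine hx ⟨a, b - a + 1, ?_⟩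
  have ht : Tendsto (fun y : ℝ => y - 1) (𝓝 (x + 1)) (𝓝 x) := by
    have : Continuous fun y : ℝ => y - 1 := by fun_prop
    simpa using this.tendsto (x + 1)
  filter_upwards [ht.eventually h] with y hy
  have := h1 (y - 1)
  rw [sub_add_cancel] at this
  linarith

theorem hasBoundedDistortion_of_pl {F : ℝ ≃o ℝ} (h1 : ∀ x, F (x + 1) = F x + 1)
    (hfin : {x ∈ Ico (0 : ℝ) 1 | ¬ ∃ a b : ℝ, ∀ᶠ y in 𝓝 x, F y = a * y + b}.Finite) :
    HasBoundedDistortion F := by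
  refine hasBoundedDistortion_of_finite_breaks F.continuous F.strictMono ?_
  refine ((hfin.union (hfin.image (· + 1))).union (finite_singleton 2)).subset ?_
  rintro x ⟨hx, h0, h2⟩
  rcases lt_or_ge x 1 with hlt | hge
  · exact .inl (.inl ⟨⟨h0, hlt⟩, hx⟩)
  rcases h2.lt_or_eq with hlt | rfl
  · refine .inl (.inr ⟨x - 1, ⟨⟨by linarith, by linarith⟩, ?_⟩, by simp⟩)
    exact mem_breaks_of_add_one h1 (by simpa using hx)
  · exact .inr rfl

theorem exists_lift_hasBoundedDistortion {G : Subgroup homeoPlus}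
    (hG : (∀ g ∈ G, IsPL g) ∨ (∀ g ∈ G, IsC1BV g)) {g : homeoPlus} (hg : g ∈ G) :
    ∃ F : ℝ ≃o ℝ, IsLift F g ∧ HasBoundedDistortion F := by
  rcases hG with hG | hG
  · obtain ⟨F, hF, hfin⟩ := hG g hg
    exact ⟨F, hF, hasBoundedDistortion_of_pl hF.map_add_one hfin⟩
  · obtain ⟨F, hF, hC, hbv⟩ := hG g hg
    -- Since G is a group, the inverse is also C¹, which supplies the differentiability of `F.symm`.
    obtain ⟨K, hK, hKC, -⟩ := hG g⁻¹ (G.inv_mem hg)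
    obtain ⟨k, hk⟩ := hK.exists_int (hF.symm)
    refine ⟨F, hF, hasBoundedDistortion_of_c1bv hF.map_add_one hC ?_ hbv⟩
    have : (F.symm : ℝ → ℝ) = fun x => K x + k := funext hk
    rw [this]
    exact (hKC.differentiable one_ne_zero).add_const _

/-! ### Conjugation to a rotation -/

/-- An increasing homeomorphism of the line that commutes with the unit translation descends to the
circle. -/
theorem exists_isLift {F : ℝ ≃o ℝ} (h1 : ∀ x, F (x + 1) = F x + 1) :
    ∃ f : homeoPlus, IsLift F f := by
  have desc : ∀ F : ℝ ≃o ℝ, (∀ x, F (x + 1) = F x + 1) →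
      ∃ f : UnitAddCircle → UnitAddCircle, Continuous f ∧
        ∀ x : ℝ, f (x : UnitAddCircle) = ((F x : ℝ) : UnitAddCircle) := by
    intro F h1
    have hper : Function.Periodic (fun x : ℝ => ((F x : ℝ) : UnitAddCircle)) 1 := fun x => by
      simp only
      rw [h1, coe_eq_coe_iff]
      exact ⟨1, by simp⟩
    refine ⟨hper.lift, ?_, fun x => hper.lift_coe x⟩
    exact continuous_coinduced_dom.2 ((AddCircle.continuous_mk' 1).comp F.continuous)
  have h1' : ∀ x, F.symm (x + 1) = F.symm x + 1 := fun x => by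
    rw [OrderIso.symm_apply_eq, h1, OrderIso.apply_symm_apply]
  obtain ⟨f, hf, hfF⟩ := desc F h1
  obtain ⟨k, hk, hkF⟩ := desc F.symm h1'
  refine ⟨⟨⟨⟨f, k, fun z => ?_, fun z => ?_⟩, hf, hk⟩, F, fun x => (hfF x).symm⟩,
    fun x => (hfF x).symm⟩ <;>
  · obtain ⟨x, rfl⟩ := QuotientAddGroup.mk_surjective z
    change _ = (x : UnitAddCircle)
    first
    | exact (congrArg k (hfF x)).trans ((hkF _).trans (by rw [OrderIso.symm_apply_apply]))
    | exact (congrArg f (hkF x)).trans ((hfF _).trans (by rw [OrderIso.apply_symm_apply]))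

theorem irrational_translationNumber {g : homeoPlus} {F : ℝ ≃o ℝ} (hF : IsLift F g)
    (hg : ∀ q : ℚ, rot g ≠ ((q : ℝ) : UnitAddCircle)) :
    Irrational hF.toDeg1.translationNumber := by
  rintro ⟨q, hq⟩
  obtain ⟨r, hr, hrot⟩ := rot_spec g F hF 0
  rw [tendsto_nhds_unique hr (hF.tendsto 0), ← hq] at hrot
  exact hg q hrot

/-- A circle homeomorphism with irrational rotation number and bounded distortion is conjugate to a
rotation. -/
theorem exists_conj_translation {g : homeoPlus} {F : ℝ ≃o ℝ} (hF : IsLift F g)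
    (hdist : HasBoundedDistortion F) (hirr : Irrational hF.toDeg1.translationNumber) :
    ∃ H : ℝ ≃o ℝ, (∀ x, H (x + 1) = H x + 1) ∧
      ∀ x, H (F x) = H x + hF.toDeg1.translationNumber := by
  set α := hF.toDeg1.translationNumber
  set T : CircleDeg1Liftˣ := CircleDeg1Lift.translate (Multiplicative.ofAdd α)
  have hunit : IsUnit hF.toDeg1 := by
    refine CircleDeg1Lift.isUnit_iff_bijective.2 F.bijective
  obtain ⟨h, hh⟩ := CircleDeg1Lift.semiconj_of_isUnit_of_translationNumber_eq hunit T.isUnit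
    (CircleDeg1Lift.translationNumber_translate α).symm
  have hsemi : ∀ x, h (F x) = h x + α := fun x => by
    have := hh x
    rw [CircleDeg1Lift.translate_apply, add_comm] at this
    exact this
  have hstrict : StrictMono h := strictMono_of_semiconj hF.map_add_one hdist hirr h.monotone
    h.map_add_one hsemi
  -- The range contains `h 0 + ℤα + ℤ`. A monotone map with dense range is continuous.
  have hdense : DenseRange h := by
    have hD : Dense (AddSubgroup.closure {α, (1 : ℝ)} : Set ℝ) :=
      dense_addSubgroupClosure_pair_iff.2 (by rwa [div_one])
    refine Dense.mono ?_ ((Homeomorph.addLeft (h 0)).surjective.denseRange.dense_image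
      (Homeomorph.addLeft (h 0)).continuous hD)
    rintro _ ⟨t, ht, rfl⟩
    obtain ⟨k, m, rfl⟩ := AddSubgroup.mem_closure_pair.1 ht
    refine ⟨(F ^ k) 0 + m, ?_⟩
    rw [map_add_intCast h.map_add_one, map_zpow_of_semiconj hsemi]
    simp [add_assoc]
  have hcont : Continuous h := h.monotone.continuous_of_denseRange hdense
  have hsurj : Function.Surjective h := hcont.surjective h.tendsto_atTop h.tendsto_atBot
  exact ⟨hstrict.orderIsoOfSurjective h hsurj, h.map_add_one, hsemi⟩

theorem dense_translations {G : Subgroup homeoPlus} {α : ℝ} (hα : Irrational α)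
    (hG : OrderIso.addRight α ∈ liftGroup G) : Dense (translations (liftGroup G) : Set ℝ) := by
  have hD : Dense (AddSubgroup.closure {α, (1 : ℝ)} : Set ℝ) :=
    dense_addSubgroupClosure_pair_iff.2 (by rwa [div_one])
  refine hD.mono ((AddSubgroup.closure_le _).2 ?_)
  rintro t (rfl | rfl)
  · exact hG
  · exact ⟨1, G.one_mem, fun x => coe_eq_coe_iff.2 ⟨1, by simp⟩⟩

theorem IsLift.conj {F H : ℝ ≃o ℝ} {f h : homeoPlus} (hF : IsLift F f) (hH : IsLift H h) :
    IsLift (H * F * H⁻¹) (h * f * h⁻¹ : homeoPlus) := fun x => by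
  change ((H (F (H.symm x)) : ℝ) : UnitAddCircle) = h.1 (f.1 (h.1.symm x))
  rw [hH, hF, hH.symm]

end CircleGroups

theorem theorem1p11 (G : Subgroup CircleGroups.homeoPlus)
    (hG : (∀ g ∈ G, CircleGroups.IsPL g) ∨ (∀ g ∈ G, CircleGroups.IsC1BV g))
    (hirr : ∃ g ∈ G, ∀ q : ℚ, CircleGroups.rot g ≠ ((q : ℝ) : UnitAddCircle)) :
    (CircleGroups.IsConjToRotations G ∧ ∀ a ∈ G, ∀ b ∈ G, a * b = b * a) ∨
      CircleGroups.HasNonabelianFreeSubgroup G := by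
  obtain ⟨g, hg, hgirr⟩ := hirr
  obtain ⟨F, hF, hdist⟩ := CircleGroups.exists_lift_hasBoundedDistortion hG hg
  have hα := CircleGroups.irrational_translationNumber hF hgirr
  obtain ⟨H, hH1, hHF⟩ := CircleGroups.exists_conj_translation hF hdist hα
  obtain ⟨h, hH⟩ := CircleGroups.exists_isLift hH1
  set G' := G.map (MulAut.conj h).toMonoidHom
  have hmem : ∀ f ∈ G, ∀ K : ℝ ≃o ℝ, CircleGroups.IsLift K f →
      H * K * H⁻¹ ∈ CircleGroups.liftGroup G' := fun f hf K hK =>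
    ⟨h * f * h⁻¹, Subgroup.mem_map_of_mem _ hf, hK.conj hH⟩
  -- Conjugation by `H` turns `F` into translation by α.
  have hD : Dense (CircleGroups.translations (CircleGroups.liftGroup G') : Set ℝ) := by
    refine CircleGroups.dense_translations hα ?_
    convert hmem g hg F hF
    ext x
    rw [RelIso.mul_apply, RelIso.mul_apply, hHF, RelIso.apply_inv_self, OrderIso.addRight_apply]
  by_cases hrot : ∀ γ ∈ CircleGroups.liftGroup G', ∀ x, γ x = x + γ 0
  · left
    have hconj : ∀ f ∈ G, ∃ a : UnitAddCircle, ∀ x : UnitAddCircle,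
        (h * f * h⁻¹ : CircleGroups.homeoPlus).1 x = x + a := by
      intro f hf
      obtain ⟨K, hK⟩ := f.2
      refine ⟨(((H * K * H⁻¹) 0 : ℝ) : UnitAddCircle), fun z => ?_⟩
      obtain ⟨x, rfl⟩ := QuotientAddGroup.mk_surjective z
      change (h * f * h⁻¹ : CircleGroups.homeoPlus).1 (x : UnitAddCircle) = (x : UnitAddCircle) + _
      rw [← CircleGroups.IsLift.conj hK hH x, hrot _ (hmem f hf K hK), AddCircle.coe_add]
    refine ⟨⟨h, hconj⟩, fun a ha b hb => ?_⟩
    obtain ⟨s, hs⟩ := hconj a ha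
    obtain ⟨t, ht⟩ := hconj b hb
    have hcomm : (h * a * h⁻¹) * (h * b * h⁻¹) = (h * b * h⁻¹) * (h * a * h⁻¹) := by
      ext x
      change (h * a * h⁻¹ : CircleGroups.homeoPlus).1 ((h * b * h⁻¹ : CircleGroups.homeoPlus).1 x) =
        (h * b * h⁻¹ : CircleGroups.homeoPlus).1 ((h * a * h⁻¹ : CircleGroups.homeoPlus).1 x)
      rw [hs, ht, hs, ht, add_right_comm]
    exact (MulAut.conj h).injective (by simpa only [map_mul, MulAut.conj_apply] using hcomm)
  · right
    obtain ⟨φ, hφ, hφG⟩ := CircleGroups.exists_injective_freeGroup hD hrot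
    -- The free group lies in the conjugate `G'` and is conjugated back into `G`.
    refine CircleGroups.hasNonabelianFreeSubgroup_of_injective
      ((MulAut.conj h⁻¹).toMonoidHom.comp φ) ((MulAut.conj h⁻¹).injective.comp hφ) fun w => ?_
    obtain ⟨f, hf, hfw⟩ := hφG w
    change MulAut.conj h⁻¹ (φ w) ∈ G
    rw [← hfw]
    simpa [mul_assoc] using hf
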